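/- Let $A$ be a definite quaternion algebra over $\mathbb{Q}$, that is, a four-dimensional central simple $\mathbb{Q}$-algebra with $A\otimes_{\mathbb{Q}}\mathbb{R}$ isomorphic to Hamilton's quaternions $\mathbb{H}$; fix such an isomorphism and use it to regard $A$ as a subring of $\mathbb{H}$. Let $\mathcal{O}$ be a (not necessarily maximal) order in $A$, that is, a unital subring which is finitely generated as a $\mathbb{Z}$-module and generates $A$ as a $\mathbb{Q}$-vector space. Write $\operatorname{n}(x)=x\overline{x}$ and $\operatorname{tr}(x)=x+\overline{x}$ for $x\in\mathbb{H}$. A binary Hamiltonian form is a map $f:\mathbb{H}\times\mathbb{H}\to\mathbb{R}$ of the form $$f(u,v)=a\operatorname{n}(u)+\operatorname{tr}(\overline{u}\,b\,v)+c\operatorname{n}(v),\qquad a,c\in\mathbb{R},\ b\in\mathbb{H};$$ its discriminant is $\Delta(f)=\operatorname{n}(b)-ac$, and it is integral over $\mathcal{O}$ if $a,b,c\in\mathcal{O}$. It is positive definite if $f(x)\ge 0$ for all $x$, with equality if and only if $x=0$, and indefinite if it takes both positive and negative values. Let $\operatorname{SL}_2(\mathcal{O})$ be the group of invertible $2\times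 2$ matrices over $\mathbb{H}$ with entries in $\mathcal{O}$ and Dieudonné determinant $1$, where the Dieudonné determinant of $\begin{pmatrix}\alpha&\beta\\ \gamma&\delta\end{pmatrix}$ is the nonnegative square root of $\operatorname{n}(\alpha\delta)+\operatorname{n}(\beta\gamma)-\operatorname{tr}(\alpha\overline{\gamma}\delta\overline{\beta})$. It acts on the right on binary Hamiltonian forms by $f\mapsto f\circ g$, where $g$ acts linearly on the left on $\mathbb{H}\times\mathbb{H}$; this action preserves the discriminant, integrality over $\mathcal{O}$, positive definiteness and indefiniteness. Then for every $\Delta\in\mathbb{Z}\setminus\{0\}$ the number of orbits of $\operatorname{SL}_2(\mathcal{O})$ in each of the following three sets is finite: the set $\mathcal{Q}(\mathcal{O},\Delta)$ of binary Hamiltonian forms which are integral over $\mathcal{O}$ and have discriminant $\Delta$, its subset $\mathcal{Q}^+(\mathcal{O},\Delta)$ of positive definite forms, and its subset $\mathcal{Q}^{\pm}(\mathcal{O},\Delta)$ of indefinite forms. -/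

import Mathlib

open scoped Quaternion TensorProduct

noncomputable section

namespace HamiltonBianchi

/-- The reduced trace `tr x = x + x̄` of a real quaternion, as a real number. -/
def tr (x : ℍ[ℝ]) : ℝ := 2 * x.re

theorem coe_tr (x : ℍ[ℝ]) : (tr x : ℍ[ℝ]) = x + star x := by
  ext
  · simp [tr]
    ring
  all_goals simp [tr]

/-- The reduced norm `n x = x x̄` of a real quaternion, as a real number. -/
abbrev nrd (x : ℍ[ℝ]) : ℝ := Quaternion.normSq x

theorem coe_nrd (x : ℍ[ℝ]) : (nrd x : ℍ[ℝ]) = x * star x :=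
  (Quaternion.self_mul_star x).symm

/-! ### Binary Hamiltonian forms -/

/-- A binary Hamiltonian form, given by its coefficients `a, c ∈ ℝ` and `b ∈ ℍ`. It is identified
with the map `toFun : ℍ × ℍ → ℝ` below, which determines the coefficients
(`BinaryHamiltonianForm.toFun_injective`). -/
@[ext]
structure BinaryHamiltonianForm where
  a : ℝ
  b : ℍ[ℝ]
  c : ℝ

/-- A Hermitian form on the right `ℍ`-module `ℍ × ℍ`, sesquilinear on the left. -/
structure IsHermitianForm (φ : ℍ[ℝ] × ℍ[ℝ] → ℍ[ℝ] × ℍ[ℝ] → ℍ[ℝ]) : Prop where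
  smul_left : ∀ X Y l, φ (X.1 * l, X.2 * l) Y = star l * φ X Y
  add_left : ∀ X X' Y, φ (X + X') Y = φ X Y + φ X' Y
  conj_symm : ∀ X Y, φ Y X = star (φ X Y)

namespace BinaryHamiltonianForm

/-- The map `f(u, v) = a n(u) + tr(ū b v) + c n(v)`. -/
def toFun (f : BinaryHamiltonianForm) (X : ℍ[ℝ] × ℍ[ℝ]) : ℝ :=
  f.a * nrd X.1 + tr (star X.1 * f.b * X.2) + f.c * nrd X.2

theorem toFun_injective : Function.Injective toFun := by
  intro f g h
  have key : ∀ u v, toFun f (u, v) = toFun g (u, v) := fun u v => by rw [h]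
  have ha : f.a = g.a := by simpa [toFun, tr] using key 1 0
  have hc : f.c = g.c := by simpa [toFun, tr] using key 0 1
  have hb : ∀ v, (f.b * v).re = (g.b * v).re := fun v => by
    simpa [toFun, tr, ha, hc] using key 1 v
  simp only [Quaternion.re_mul] at hb
  have h1 := hb 1
  have h2 := hb ⟨0, 1, 0, 0⟩
  have h3 := hb ⟨0, 0, 1, 0⟩
  have h4 := hb ⟨0, 0, 0, 1⟩
  simp at h1 h2 h3 h4
  ext <;> assumption

theorem coe_toFun (f : BinaryHamiltonianForm) (X : ℍ[ℝ] × ℍ[ℝ]) :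
    (f.toFun X : ℍ[ℝ]) = star X.1 * (f.a : ℍ[ℝ]) * X.1 + star X.1 * f.b * X.2
      + star X.2 * star f.b * X.1 + star X.2 * (f.c : ℍ[ℝ]) * X.2 := by
  rw [toFun, Quaternion.coe_add, Quaternion.coe_add, coe_tr, Quaternion.coe_mul,
    Quaternion.coe_mul, ← Quaternion.star_mul_self, ← Quaternion.star_mul_self,
    ← (Quaternion.coe_commute f.a (star X.1)).eq, ← (Quaternion.coe_commute f.c (star X.2)).eq]
  simp only [star_mul, star_star, mul_assoc]
  abel

/-- The maps `toFun f` are exactly the maps `X ↦ φ(X, X)` for `φ` a Hermitian form. -/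
theorem exists_toFun_eq_iff (F : ℍ[ℝ] × ℍ[ℝ] → ℝ) :
    (∃ f : BinaryHamiltonianForm, f.toFun = F) ↔
      ∃ φ, IsHermitianForm φ ∧ ∀ X, φ X X = (F X : ℍ[ℝ]) := by
  constructor
  · rintro ⟨f, rfl⟩
    refine ⟨fun X Y => star X.1 * (f.a : ℍ[ℝ]) * Y.1 + star X.1 * f.b * Y.2
      + star X.2 * star f.b * Y.1 + star X.2 * (f.c : ℍ[ℝ]) * Y.2, ⟨?_, ?_, ?_⟩, ?_⟩
    · intro X Y l
      simp only [star_mul]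
      noncomm_ring
    · intro X X' Y
      simp only [Prod.fst_add, Prod.snd_add, star_add]
      noncomm_ring
    · intro X Y
      simp only [star_add, star_mul, star_star, Quaternion.star_coe, mul_assoc]
      abel
    · intro X
      exact (coe_toFun f X).symm
  · rintro ⟨φ, hφ, hF⟩
    have hdec : ∀ u v, φ (u, v) (u, v) = star u * φ (1, 0) (1, 0) * u + star u * φ (1, 0) (0, 1) * v
        + star (star u * φ (1, 0) (0, 1) * v) + star v * φ (0, 1) (0, 1) * v := by
      intro u v
      have hl : ∀ u v Y, φ (u, v) Y = star u * φ (1, 0) Y + star v * φ (0, 1) Y := by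
        intro u v Y
        have h1 := hφ.smul_left (1, 0) Y u
        have h2 := hφ.smul_left (0, 1) Y v
        simp only [one_mul, zero_mul] at h1 h2
        rw [← h1, ← h2, ← hφ.add_left]
        simp
      have hr : ∀ u v Y, φ Y (u, v) = φ Y (1, 0) * u + φ Y (0, 1) * v := by
        intro u v Y
        rw [hφ.conj_symm (u, v) Y, hl, star_add, star_mul, star_mul, star_star, star_star,
          ← hφ.conj_symm, ← hφ.conj_symm]
      rw [hl u v, hr u v (1, 0), hr u v (0, 1), hφ.conj_symm (1, 0) (0, 1)]
      simp only [star_mul, star_star, mul_add, mul_assoc]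
      abel
    refine ⟨⟨F (1, 0), φ (1, 0) (0, 1), F (0, 1)⟩, ?_⟩
    funext ⟨u, v⟩
    apply Quaternion.coe_injective
    rw [← hF, hdec, coe_toFun, hF, hF]
    simp only [star_mul, star_star, mul_assoc]

/-- The Hermitian matrix of a binary Hamiltonian form. -/
def matrix (f : BinaryHamiltonianForm) : Matrix (Fin 2) (Fin 2) ℍ[ℝ] :=
  !![(f.a : ℍ[ℝ]), f.b; star f.b, (f.c : ℍ[ℝ])]

/-- The discriminant `Δ(f) = n(b) - a c`. -/
def disc (f : BinaryHamiltonianForm) : ℝ := nrd f.b - f.a * f.c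

/-- `f ≥ 0`, with equality only at the origin. -/
def IsPosDef (f : BinaryHamiltonianForm) : Prop :=
  ∀ X, 0 ≤ f.toFun X ∧ (f.toFun X = 0 ↔ X = 0)

/-- `f` takes both positive and negative values. -/
def IsIndefinite (f : BinaryHamiltonianForm) : Prop :=
  (∃ X, 0 < f.toFun X) ∧ ∃ X, f.toFun X < 0

/-- `f` is integral over a subring `R` of `ℍ` if its coefficients belong to `R`. -/
def IsIntegralOver (R : Subring ℍ[ℝ]) (f : BinaryHamiltonianForm) : Prop :=
  (f.a : ℍ[ℝ]) ∈ R ∧ f.b ∈ R ∧ (f.c : ℍ[ℝ]) ∈ R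

end BinaryHamiltonianForm

/-! ### The action of matrices on `ℍ × ℍ` and on forms -/

/-- The linear action of `2 × 2` matrices on the left on the right `ℍ`-module `ℍ × ℍ`. -/
def matMul (g : Matrix (Fin 2) (Fin 2) ℍ[ℝ]) (X : ℍ[ℝ] × ℍ[ℝ]) : ℍ[ℝ] × ℍ[ℝ] :=
  (g 0 0 * X.1 + g 0 1 * X.2, g 1 0 * X.1 + g 1 1 * X.2)

theorem matMul_one (X : ℍ[ℝ] × ℍ[ℝ]) : matMul 1 X = X := by
  simp [matMul]

theorem matMul_mul (g h : Matrix (Fin 2) (Fin 2) ℍ[ℝ]) (X : ℍ[ℝ] × ℍ[ℝ]) :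
    matMul (g * h) X = matMul g (matMul h X) := by
  ext1 <;> simp only [matMul, Matrix.mul_apply, Fin.sum_univ_two] <;> noncomm_ring

namespace BinaryHamiltonianForm

/-- The form `f ∘ g` (see `toFun_comp`). -/
def comp (f : BinaryHamiltonianForm) (g : Matrix (Fin 2) (Fin 2) ℍ[ℝ]) :
    BinaryHamiltonianForm where
  a := f.toFun (g 0 0, g 1 0)
  b := star (g 0 0) * f.a * g 0 1 + star (g 0 0) * f.b * g 1 1
    + star (g 1 0) * star f.b * g 0 1 + star (g 1 0) * f.c * g 1 1
  c := f.toFun (g 0 1, g 1 1)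

theorem toFun_comp (f : BinaryHamiltonianForm) (g : Matrix (Fin 2) (Fin 2) ℍ[ℝ]) :
    (f.comp g).toFun = f.toFun ∘ matMul g := by
  funext X
  apply Quaternion.coe_injective
  rw [coe_toFun]
  simp only [comp, coe_toFun, Function.comp_apply, matMul, star_add, star_mul, star_star,
    Quaternion.star_coe]
  noncomm_ring

/-- The matrix of `f ∘ g` is `g* M(f) g`. -/
theorem matrix_comp (f : BinaryHamiltonianForm) (g : Matrix (Fin 2) (Fin 2) ℍ[ℝ]) :
    (f.comp g).matrix = g.conjTranspose * f.matrix * g := by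
  apply Matrix.ext
  intro i j
  fin_cases i <;> fin_cases j <;>
    simp [matrix, comp, coe_toFun, Matrix.mul_apply, Fin.sum_univ_two,
      Matrix.conjTranspose_apply] <;> noncomm_ring

/-- Invertible matrices act on the right on binary Hamiltonian forms, by precomposition. -/
instance : MulAction (Matrix (Fin 2) (Fin 2) ℍ[ℝ])ˣᵐᵒᵖ BinaryHamiltonianForm where
  smul g f := f.comp (g.unop : Matrix (Fin 2) (Fin 2) ℍ[ℝ])
  one_smul f := by
    apply toFun_injective
    change (f.comp ((1 : (Matrix (Fin 2) (Fin 2) ℍ[ℝ])ˣ) : Matrix (Fin 2) (Fin 2) ℍ[ℝ])).toFun = _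
    rw [toFun_comp]
    funext X
    simp [matMul_one]
  mul_smul g h f := by
    apply toFun_injective
    change (f.comp ((h.unop * g.unop : (Matrix (Fin 2) (Fin 2) ℍ[ℝ])ˣ) :
        Matrix (Fin 2) (Fin 2) ℍ[ℝ])).toFun = ((f.comp (h.unop : Matrix (Fin 2) (Fin 2) ℍ[ℝ])).comp
      (g.unop : Matrix (Fin 2) (Fin 2) ℍ[ℝ])).toFun
    rw [toFun_comp, toFun_comp, toFun_comp]
    funext X
    simp [matMul_mul]

theorem op_smul_def (g : (Matrix (Fin 2) (Fin 2) ℍ[ℝ])ˣ) (f : BinaryHamiltonianForm) :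
    MulOpposite.op g • f = f.comp g := rfl

end BinaryHamiltonianForm

/-! ### The Dieudonné determinant -/

/-- The square of the Dieudonné determinant of a `2 × 2` matrix over `ℍ`. -/
def dieudonneSq (g : Matrix (Fin 2) (Fin 2) ℍ[ℝ]) : ℝ :=
  nrd (g 0 0 * g 1 1) + nrd (g 0 1 * g 1 0)
    - tr (g 0 0 * star (g 1 0) * g 1 1 * star (g 0 1))

/-- The Dieudonné determinant of a `2 × 2` matrix over `ℍ`. -/
def dieudonneDet (g : Matrix (Fin 2) (Fin 2) ℍ[ℝ]) : ℝ := √(dieudonneSq g)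

theorem re_mul_comm (x y : ℍ[ℝ]) : (x * y).re = (y * x).re := by
  simp only [Quaternion.re_mul]
  ring

theorem re_star_mul_mul (x m : ℍ[ℝ]) : (star x * m * x).re = nrd x * m.re := by
  rw [re_mul_comm, ← mul_assoc, Quaternion.self_mul_star, Quaternion.coe_mul_eq_smul]
  simp

theorem re_mul_self_star_mul (p y q : ℍ[ℝ]) :
    (p * y * star y * q).re = nrd y * (p * q).re := by
  rw [mul_assoc p, Quaternion.self_mul_star, Quaternion.mul_coe_eq_smul, smul_mul_assoc]
  simp

theorem re_mul_re (p q : ℍ[ℝ]) : 2 * (p.re * q.re) = (p * q).re + (p * star q).re := by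
  simp only [Quaternion.re_mul, Quaternion.re_star, Quaternion.imI_star, Quaternion.imJ_star,
    Quaternion.imK_star]
  ring

theorem disc_comp (f : BinaryHamiltonianForm) (g : Matrix (Fin 2) (Fin 2) ℍ[ℝ]) :
    (f.comp g).disc = dieudonneSq g * f.disc := by
  obtain ⟨a, b, c⟩ := f
  simp only [BinaryHamiltonianForm.comp, BinaryHamiltonianForm.disc, dieudonneSq,
    BinaryHamiltonianForm.toFun, tr, nrd]
  generalize g 0 0 = x
  generalize g 0 1 = y
  generalize g 1 0 = z
  generalize g 1 1 = w
  have hPQ : (star x * y * star (star x * b * w)).re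
      = nrd x * (star y * b * w).re := by
    have : star x * y * star (star x * b * w) = star x * (y * star w * star b) * x := by
      simp only [star_mul, star_star, mul_assoc]
    rw [this, re_star_mul_mul, ← Quaternion.re_star (y * star w * star b), re_mul_comm (star y * b)]
    simp only [star_mul, star_star, mul_assoc]
    rw [re_mul_comm b, mul_assoc, re_mul_comm w, mul_assoc, re_mul_comm (star y)]
  have hPR : (star x * y * star (star z * star b * y)).re
      = nrd y * (star x * b * z).re := by
    have : star x * y * star (star z * star b * y) = star x * y * star y * (b * z) := by
      simp only [star_mul, star_star, mul_assoc]
    rw [this, re_mul_self_star_mul, mul_assoc]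
  have hPS : (star x * y * star (star z * w)).re = (star x * y * star w * z).re := by
    simp only [star_mul, star_star, mul_assoc]
  have hQR : (star x * b * w * star (star z * star b * y)).re
      = (b * w * star y * (b * z * star x)).re := by
    rw [re_mul_comm, mul_assoc (star x), ← mul_assoc, re_mul_comm]
    simp only [star_mul, star_star, mul_assoc]
  have hQS : (star x * b * w * star (star z * w)).re = nrd w * (star x * b * z).re := by
    have : star x * b * w * star (star z * w) = star x * b * w * star w * z := by
      simp only [star_mul, star_star, mul_assoc]
    rw [this, re_mul_self_star_mul]
  have hRS : (star z * star b * y * star (star z * w)).re = nrd z * (star y * b * w).re := by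
    have : star z * star b * y * star (star z * w) = star z * (star b * y * star w) * z := by
      simp only [star_mul, star_star, mul_assoc]
    rw [this, re_star_mul_mul, re_mul_comm, ← Quaternion.re_star (star y * b * w)]
    simp only [star_mul, star_star, mul_assoc]
  have hTS : 2 * ((star x * b * z).re * (star y * b * w).re)
      = (b * w * star y * (b * z * star x)).re + nrd b * (star x * y * star w * z).re := by
    have h1 : (star x * b * z).re = (b * z * star x).re := by rw [mul_assoc, re_mul_comm]
    have h2 : (star y * b * w).re = (b * w * star y).re := by rw [mul_assoc, re_mul_comm]
    have h3 : (b * z * star x * star (b * w * star y)).re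
        = nrd b * (star x * y * star w * z).re := by
      have : b * z * star x * star (b * w * star y)
          = star (star b) * (z * (star x * y * star w)) * star b := by
        simp only [star_mul, star_star, mul_assoc]
      rw [this, re_star_mul_mul, re_mul_comm z, nrd, Quaternion.normSq_star]
    rw [h1, h2, re_mul_re, h3, re_mul_comm (b * z * star x)]
  have hD : (x * star z * w * star y).re = (star x * y * star w * z).re := by
    rw [← Quaternion.re_star, mul_assoc (star x), mul_assoc (star x), re_mul_comm (star x)]
    simp only [star_mul, star_star, mul_assoc]
  have e1 : star x * (a : ℍ[ℝ]) * y = a • (star x * y) := by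
    rw [Quaternion.mul_coe_eq_smul, smul_mul_assoc]
  have e2 : star z * (c : ℍ[ℝ]) * w = c • (star z * w) := by
    rw [Quaternion.mul_coe_eq_smul, smul_mul_assoc]
  rw [e1, e2, Quaternion.normSq_add, Quaternion.normSq_add, Quaternion.normSq_add]
  simp only [add_mul, Quaternion.re_add, Quaternion.star_smul, smul_mul_assoc, mul_smul_comm,
    Quaternion.re_smul, hPQ, hPR, hPS, hQR, hQS, hRS, hD, Quaternion.normSq_smul, map_mul,
    Quaternion.normSq_star, smul_eq_mul, nrd] at hTS ⊢
  linear_combination (-2) * hTS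

theorem dieudonneSq_mul (g h : Matrix (Fin 2) (Fin 2) ℍ[ℝ]) :
    dieudonneSq (g * h) = dieudonneSq g * dieudonneSq h := by
  have key : ∀ k, dieudonneSq k = ((⟨0, 1, 0⟩ : BinaryHamiltonianForm).comp k).disc := by
    intro k
    rw [disc_comp]
    simp [BinaryHamiltonianForm.disc]
  have hc : (⟨0, 1, 0⟩ : BinaryHamiltonianForm).comp (g * h)
      = ((⟨0, 1, 0⟩ : BinaryHamiltonianForm).comp g).comp h := by
    apply BinaryHamiltonianForm.toFun_injective
    simp only [BinaryHamiltonianForm.toFun_comp]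
    funext X
    simp [matMul_mul]
  rw [key, hc, disc_comp, ← key, mul_comm]

theorem dieudonneSq_one : dieudonneSq 1 = 1 := by
  simp [dieudonneSq, tr]

theorem dieudonneDet_eq_one_iff {g : Matrix (Fin 2) (Fin 2) ℍ[ℝ]} :
    dieudonneDet g = 1 ↔ dieudonneSq g = 1 :=
  Real.sqrt_eq_one

/-- `SL₂(ℍ)`, the group of invertible matrices of Dieudonné determinant `1`. -/
def SL2H : Subgroup (Matrix (Fin 2) (Fin 2) ℍ[ℝ])ˣ where
  carrier := {g | dieudonneDet g = 1}
  one_mem' := by simp [dieudonneDet_eq_one_iff, dieudonneSq_one]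
  mul_mem' := by
    intro g h hg hh
    simp only [Set.mem_ofPred_eq, dieudonneDet_eq_one_iff] at hg hh ⊢
    rw [Units.val_mul, dieudonneSq_mul, hg, hh, one_mul]
  inv_mem' := by
    intro g hg
    simp only [Set.mem_ofPred_eq, dieudonneDet_eq_one_iff] at hg ⊢
    have := dieudonneSq_mul (g : Matrix (Fin 2) (Fin 2) ℍ[ℝ]) (g⁻¹ : (Matrix (Fin 2) (Fin 2) ℍ[ℝ])ˣ)
    rw [Units.mul_inv, dieudonneSq_one, hg, one_mul] at this
    exact this.symm

theorem mem_SL2H {g : (Matrix (Fin 2) (Fin 2) ℍ[ℝ])ˣ} :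
    g ∈ SL2H ↔ dieudonneDet (g : Matrix (Fin 2) (Fin 2) ℍ[ℝ]) = 1 := Iff.rfl

/-- A right inverse of a matrix of Dieudonné determinant `1`. -/
def adj (g : Matrix (Fin 2) (Fin 2) ℍ[ℝ]) : Matrix (Fin 2) (Fin 2) ℍ[ℝ] :=
  !![g 1 1 * star (g 1 1) * star (g 0 0) - star (g 1 0) * g 1 1 * star (g 0 1),
     g 0 1 * star (g 0 1) * star (g 1 0) - star (g 0 0) * g 0 1 * star (g 1 1);
     g 1 0 * star (g 1 0) * star (g 0 1) - star (g 1 1) * g 1 0 * star (g 0 0),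
     g 0 0 * star (g 0 0) * star (g 1 1) - star (g 0 1) * g 0 0 * star (g 1 0)]

theorem mul_adj (g : Matrix (Fin 2) (Fin 2) ℍ[ℝ]) (hg : dieudonneSq g = 1) : g * adj g = 1 := by
  have hg' : (dieudonneSq g : ℍ[ℝ]) = 1 := by rw [hg]; simp
  simp only [dieudonneSq, Quaternion.coe_add, Quaternion.coe_sub, coe_tr, map_mul, nrd,
    Quaternion.coe_mul, star_mul, star_star, Quaternion.coe_mul_eq_smul] at hg'
  have h3 : ∀ q r : ℍ[ℝ], q * (star q * r) = Quaternion.normSq q • r := fun q r => by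
    rw [← mul_assoc q, Quaternion.self_mul_star, Quaternion.coe_mul_eq_smul]
  have h4 : ∀ q : ℍ[ℝ], q * star q = Quaternion.normSq q • 1 := fun q => by
    rw [Quaternion.self_mul_star, ← Quaternion.coe_mul_eq_smul, mul_one]
  have h5 : ∀ r : ℝ, (r : ℍ[ℝ]) = r • 1 := fun r => by
    rw [← Quaternion.coe_mul_eq_smul, mul_one]
  simp only [mul_assoc, h5, smul_smul] at hg'
  apply Matrix.ext
  intro i j
  fin_cases i <;> fin_cases j <;>
    simp [adj, Matrix.mul_apply, Fin.sum_univ_two, mul_sub, mul_assoc, h3, h4, smul_smul]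
  · rw [mul_comm (Quaternion.normSq (g 1 1)), mul_comm (Quaternion.normSq (g 1 0))]
    refine Eq.trans ?_ hg'
    abel
  · have hcomm : g 0 0 * (star (g 1 0) * (g 1 1 * star (g 0 1)))
        + g 0 1 * (star (g 1 1) * (g 1 0 * star (g 0 0)))
        = g 1 1 * (star (g 0 1) * (g 0 0 * star (g 1 0)))
        + g 1 0 * (star (g 0 0) * (g 0 1 * star (g 1 1))) := by
      have h6 := coe_tr (g 0 0 * star (g 1 0) * (g 1 1 * star (g 0 1)))
      have h7 := coe_tr (g 1 1 * star (g 0 1) * (g 0 0 * star (g 1 0)))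
      rw [tr, re_mul_comm, ← tr, h7] at h6
      simpa [mul_assoc] using h6.symm
    rw [hcomm] at hg'
    refine Eq.trans ?_ hg'
    abel

/-! ### Orders in definite quaternion algebras -/

/-- An order in a `ℚ`-algebra: a unital subring which is finitely generated as a `ℤ`-module and
generates the algebra as a `ℚ`-vector space. -/
structure IsOrder {A : Type*} [Ring A] [Algebra ℚ A] (O : Subring A) : Prop where
  fg : O.toAddSubgroup.FG
  span_eq_top : Submodule.span ℚ (O : Set A) = ⊤

/-- The image in `ℍ` of a subring `O` of `A`, under the identification `ι` of `ℝ ⊗ A` with `ℍ`. -/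
def imageInH {A : Type*} [Ring A] [Algebra ℚ A] (ι : ℝ ⊗[ℚ] A ≃ₐ[ℝ] ℍ[ℝ]) (O : Subring A) :
    Subring ℍ[ℝ] :=
  O.map ((ι : ℝ ⊗[ℚ] A →+* ℍ[ℝ]).comp
    (Algebra.TensorProduct.includeRight : A →ₐ[ℚ] ℝ ⊗[ℚ] A).toRingHom)

theorem mem_imageInH {A : Type*} [Ring A] [Algebra ℚ A] {ι : ℝ ⊗[ℚ] A ≃ₐ[ℝ] ℍ[ℝ]} {O : Subring A}
    {x : ℍ[ℝ]} : x ∈ imageInH ι O ↔ ∃ y ∈ O, ι (1 ⊗ₜ y) = x := Iff.rfl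

/-- Orders are stable under conjugation. -/
theorem IsOrder.star_mem {A : Type*} [Ring A] [Algebra ℚ A] {O : Subring A} (hO : IsOrder O)
    (ι : ℝ ⊗[ℚ] A ≃ₐ[ℝ] ℍ[ℝ]) {x : ℍ[ℝ]} (hx : x ∈ imageInH ι O) : star x ∈ imageInH ι O := by
  obtain ⟨y, hy, rfl⟩ := mem_imageInH.1 hx
  have hyint : IsIntegral ℤ y := by
    refine IsIntegral.of_mem_of_fg (subalgebraOfSubring O) ?_ y (by simpa using hy)
    have := hO.fg
    rw [← AddSubgroup.toIntSubmodule_toAddSubgroup O.toAddSubgroup] at this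
    exact (Submodule.fg_iff_addSubgroup_fg _).2 this
  set x : ℍ[ℝ] := ι (1 ⊗ₜ y) with hxdef
  have hxint : IsIntegral ℤ x := by
    let F : A →+* ℍ[ℝ] := (ι : ℝ ⊗[ℚ] A →+* ℍ[ℝ]).comp
      (Algebra.TensorProduct.includeRight : A →ₐ[ℚ] ℝ ⊗[ℚ] A).toRingHom
    exact hyint.map F.toIntAlgHom
  have hsint : IsIntegral ℤ (star x) := by
    obtain ⟨p, hp, hpx⟩ := hxint
    refine ⟨p, hp, ?_⟩
    rw [Polynomial.eval₂_eq_sum_range] at hpx ⊢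
    have := congrArg star hpx
    simpa [star_sum, star_mul, ← (Int.cast_commute _ _).eq] using this
  have htint : IsIntegral ℤ (tr x) := by
    have hcomm : ∀ a ∈ ({x, star x} : Set ℍ[ℝ]), ∀ b ∈ ({x, star x} : Set ℍ[ℝ]),
        a * b = b * a := by
      rintro a (rfl | rfl) b (rfl | rfl)
      · rfl
      · exact Quaternion.self_mul_star x ▸ (Quaternion.star_mul_self x).symm
      · exact Quaternion.self_mul_star x ▸ (Quaternion.star_mul_self x)
      · rfl
    have := Algebra.isMulCommutative_adjoin ℤ hcomm
    let S := Algebra.adjoin ℤ ({x, star x} : Set ℍ[ℝ])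
    let x₁ : S := ⟨x, Algebra.subset_adjoin (by simp)⟩
    let x₂ : S := ⟨star x, Algebra.subset_adjoin (by simp)⟩
    have h₁ : IsIntegral ℤ x₁ := (isIntegral_algHom_iff S.val Subtype.val_injective).1 hxint
    have h₂ : IsIntegral ℤ x₂ := (isIntegral_algHom_iff S.val Subtype.val_injective).1 hsint
    have h₃ : IsIntegral ℤ (x₁ + x₂) := by
      open scoped IsMulCommutative in exact h₁.add h₂
    have h₄ : IsIntegral ℤ (S.val (x₁ + x₂)) := h₃.map S.val
    have h₅ : S.val (x₁ + x₂) = algebraMap ℝ ℍ[ℝ] (tr x) := (coe_tr x).symm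
    rw [h₅] at h₄
    exact (isIntegral_algHom_iff ((algebraMap ℝ ℍ[ℝ]).toIntAlgHom)
      (algebraMap ℝ ℍ[ℝ]).injective).1 h₄
  have hrat : ∃ q : ℚ, (q : ℝ) = tr x := by
    have hfin : Module.Finite ℚ A := by
      obtain ⟨s, hs⟩ := hO.fg
      refine ⟨⟨s, top_le_iff.1 ?_⟩⟩
      rw [← hO.span_eq_top, Submodule.span_le]
      intro z hz
      have hz' : z ∈ AddSubgroup.closure (s : Set A) := by rw [hs]; exact hz
      have hle : AddSubgroup.closure (s : Set A) ≤ (Submodule.span ℚ (s : Set A)).toAddSubgroup :=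
        (AddSubgroup.closure_le _).2 Submodule.subset_span
      exact hle hz'
    have h1 : LinearMap.trace ℝ _ (Algebra.lmul ℝ (ℝ ⊗[ℚ] A) (1 ⊗ₜ y))
        = algebraMap ℚ ℝ (LinearMap.trace ℚ A (Algebra.lmul ℚ A y)) := by
      rw [← Algebra.baseChange_lmul, LinearMap.trace_baseChange]
    have h2 : LinearMap.trace ℝ ℍ[ℝ] (Algebra.lmul ℝ ℍ[ℝ] x)
        = LinearMap.trace ℝ _ (Algebra.lmul ℝ (ℝ ⊗[ℚ] A) (1 ⊗ₜ y)) := by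
      rw [← LinearMap.trace_conj' _ ι.toLinearEquiv]
      congr 1
      ext1 z
      simp [LinearEquiv.conj_apply, hxdef]
    have h3 : LinearMap.trace ℝ ℍ[ℝ] (Algebra.lmul ℝ ℍ[ℝ] x) = 2 * tr x := by
      let e : ℍ[ℝ] ≃ₗ[ℝ] (Fin 4 → ℝ) :=
        { toFun := fun q => ![q.re, q.imI, q.imJ, q.imK]
          invFun := fun v => ⟨v 0, v 1, v 2, v 3⟩
          map_add' := fun p q => by ext i; fin_cases i <;> simp
          map_smul' := fun r q => by ext i; fin_cases i <;> simp
          left_inv := fun q => by ext <;> simp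
          right_inv := fun v => by ext i; fin_cases i <;> simp }
      let B := Module.Basis.ofEquivFun e
      have hB : ∀ i, B i = ⟨(Pi.single i 1 : Fin 4 → ℝ) 0, (Pi.single i 1 : Fin 4 → ℝ) 1,
          (Pi.single i 1 : Fin 4 → ℝ) 2, (Pi.single i 1 : Fin 4 → ℝ) 3⟩ := fun i => by
        rw [Module.Basis.coe_ofEquivFun]
        rfl
      have hM : ∀ i, LinearMap.toMatrix B B (Algebra.lmul ℝ ℍ[ℝ] x) i i
          = ![(x * B i).re, (x * B i).imI, (x * B i).imJ, (x * B i).imK] i := fun i => by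
        rw [LinearMap.toMatrix_apply]
        rfl
      rw [LinearMap.trace_eq_matrix_trace ℝ B]
      simp only [Matrix.trace, Matrix.diag, hM, Fin.sum_univ_four, Matrix.cons_val,
        Quaternion.re_mul, Quaternion.imI_mul, Quaternion.imJ_mul, Quaternion.imK_mul, tr]
      simp [hB]
      ring
    refine ⟨LinearMap.trace ℚ A (Algebra.lmul ℚ A y) / 2, ?_⟩
    rw [h2, h1] at h3
    simp only [eq_ratCast] at h3
    push_cast
    linarith
  obtain ⟨q, hq⟩ := hrat
  have hqint : IsIntegral ℤ q := by
    rw [← hq] at htint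
    exact (isIntegral_algHom_iff ((algebraMap ℚ ℝ).toIntAlgHom) (algebraMap ℚ ℝ).injective).1 htint
  obtain ⟨m, hm⟩ := IsIntegrallyClosed.isIntegral_iff.1 hqint
  have hstar : star x = ((m : ℤ) : ℍ[ℝ]) - x := by
    have h := coe_tr x
    rw [← hq, ← hm] at h
    rw [eq_sub_iff_add_eq, add_comm, ← h]
    ext <;> simp
  rw [hstar]
  exact sub_mem (intCast_mem _ m) hx

/-! ### The group `SL₂(O)` and the integral forms -/

/-- `SL₂(O)`, the group of elements of `SL₂(ℍ)` whose entries belong to the order `O`. -/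
def SL2O {A : Type*} [Ring A] [Algebra ℚ A] (ι : ℝ ⊗[ℚ] A ≃ₐ[ℝ] ℍ[ℝ]) (O : Subring A)
    (hO : IsOrder O) : Subgroup (Matrix (Fin 2) (Fin 2) ℍ[ℝ])ˣ where
  carrier := {g | g ∈ SL2H ∧ ∀ i j, (g : Matrix (Fin 2) (Fin 2) ℍ[ℝ]) i j ∈ imageInH ι O}
  one_mem' := by
    refine ⟨one_mem _, fun i j => ?_⟩
    rw [Units.val_one, Matrix.one_apply]
    split
    · exact one_mem _
    · exact zero_mem _
  mul_mem' := by
    rintro g h ⟨hg, hg'⟩ ⟨hh, hh'⟩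
    refine ⟨mul_mem hg hh, fun i j => ?_⟩
    rw [Units.val_mul, Matrix.mul_apply]
    exact sum_mem fun k _ => mul_mem (hg' i k) (hh' k j)
  inv_mem' := by
    rintro g ⟨hg, hg'⟩
    refine ⟨inv_mem hg, ?_⟩
    have h := mul_adj g (dieudonneDet_eq_one_iff.1 (mem_SL2H.1 hg))
    have hinv : ((g⁻¹ : (Matrix (Fin 2) (Fin 2) ℍ[ℝ])ˣ) : Matrix (Fin 2) (Fin 2) ℍ[ℝ]) = adj g :=
      Units.inv_eq_of_mul_eq_one_right h
    have hs : ∀ i j, star ((g : Matrix (Fin 2) (Fin 2) ℍ[ℝ]) i j) ∈ imageInH ι O :=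
      fun i j => hO.star_mem ι (hg' i j)
    have key : ∀ i j k l m n p q r s t u, (g : Matrix (Fin 2) (Fin 2) ℍ[ℝ]) i j * star (g.1 k l) *
        star (g.1 m n) - star (g.1 p q) * g.1 r s * star (g.1 t u) ∈ imageInH ι O :=
      fun i j k l m n p q r s t u =>
        sub_mem (mul_mem (mul_mem (hg' _ _) (hs _ _)) (hs _ _))
          (mul_mem (mul_mem (hs _ _) (hg' _ _)) (hs _ _))
    intro i j
    rw [hinv]
    fin_cases i <;> fin_cases j <;> exact key _ _ _ _ _ _ _ _ _ _ _ _

section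

variable {A : Type*} [Ring A] [Algebra ℚ A] (ι : ℝ ⊗[ℚ] A ≃ₐ[ℝ] ℍ[ℝ]) (O : Subring A)

/-- The binary Hamiltonian forms integral over `O` of discriminant `Δ`. -/
def integralForms (Δ : ℤ) : Set BinaryHamiltonianForm :=
  {f | f.IsIntegralOver (imageInH ι O) ∧ f.disc = Δ}

/-- The positive definite ones. -/
def posDefIntegralForms (Δ : ℤ) : Set BinaryHamiltonianForm :=
  {f ∈ integralForms ι O Δ | f.IsPosDef}

/-- The indefinite ones. -/
def indefiniteIntegralForms (Δ : ℤ) : Set BinaryHamiltonianForm :=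
  {f ∈ integralForms ι O Δ | f.IsIndefinite}

variable {ι O} in
/-- `SL₂(O)` preserves the three sets of forms above. -/
theorem smul_mem_integralForms (hO : IsOrder O) {g : (Matrix (Fin 2) (Fin 2) ℍ[ℝ])ˣ}
    (hg : g ∈ SL2O ι O hO) {Δ : ℤ} {f : BinaryHamiltonianForm} :
    (f ∈ integralForms ι O Δ → MulOpposite.op g • f ∈ integralForms ι O Δ) ∧
    (f ∈ posDefIntegralForms ι O Δ → MulOpposite.op g • f ∈ posDefIntegralForms ι O Δ) ∧
    (f ∈ indefiniteIntegralForms ι O Δ →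
      MulOpposite.op g • f ∈ indefiniteIntegralForms ι O Δ) := by
  have hinv : ∀ X, matMul g.1 (matMul (g⁻¹).1 X) = X := fun X => by
    rw [← matMul_mul, Units.mul_inv, matMul_one]
  have hinj : ∀ X, matMul g.1 X = 0 ↔ X = 0 := fun X => by
    refine ⟨fun h => ?_, fun h => by simp [h, matMul]⟩
    rw [← matMul_one X, ← Units.inv_mul g, matMul_mul, h]
    simp [matMul]
  have h1 : f ∈ integralForms ι O Δ → MulOpposite.op g • f ∈ integralForms ι O Δ := by
    rintro ⟨⟨ha, hb, hc⟩, hd⟩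
    have hs := fun i j => hO.star_mem ι (hg.2 i j)
    have hval : ∀ i j k l, (f.toFun (g.1 i j, g.1 k l) : ℍ[ℝ]) ∈ imageInH ι O := fun i j k l => by
      rw [BinaryHamiltonianForm.coe_toFun]
      exact add_mem (add_mem (add_mem (mul_mem (mul_mem (hs _ _) ha) (hg.2 _ _))
        (mul_mem (mul_mem (hs _ _) hb) (hg.2 _ _)))
        (mul_mem (mul_mem (hs _ _) (hO.star_mem ι hb)) (hg.2 _ _)))
        (mul_mem (mul_mem (hs _ _) hc) (hg.2 _ _))
    refine ⟨⟨hval _ _ _ _, ?_, hval _ _ _ _⟩, ?_⟩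
    · exact add_mem (add_mem (add_mem (mul_mem (mul_mem (hs _ _) ha) (hg.2 _ _))
        (mul_mem (mul_mem (hs _ _) hb) (hg.2 _ _)))
        (mul_mem (mul_mem (hs _ _) (hO.star_mem ι hb)) (hg.2 _ _)))
        (mul_mem (mul_mem (hs _ _) hc) (hg.2 _ _))
    · rw [BinaryHamiltonianForm.op_smul_def, disc_comp, hd,
        dieudonneDet_eq_one_iff.1 (mem_SL2H.1 hg.1), one_mul]
  refine ⟨h1, fun ⟨hf, hp⟩ => ⟨h1 hf, fun X => ?_⟩,
    fun ⟨hf, ⟨X, hX⟩, ⟨Y, hY⟩⟩ => ⟨h1 hf, ⟨matMul (g⁻¹).1 X, ?_⟩, ⟨matMul (g⁻¹).1 Y, ?_⟩⟩⟩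
  · rw [BinaryHamiltonianForm.op_smul_def, BinaryHamiltonianForm.toFun_comp, Function.comp_apply,
      ← hinj X]
    exact hp _
  · rwa [BinaryHamiltonianForm.op_smul_def, BinaryHamiltonianForm.toFun_comp, Function.comp_apply,
      hinv]
  · rwa [BinaryHamiltonianForm.op_smul_def, BinaryHamiltonianForm.toFun_comp, Function.comp_apply,
      hinv]

/-- The set of orbits of elements of `Q` for the right action of `SL₂(O)` on binary Hamiltonian
forms by precomposition. -/
def orbits (hO : IsOrder O) (Q : Set BinaryHamiltonianForm) : Set (Set BinaryHamiltonianForm) :=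
  (fun f => MulAction.orbit (SL2O ι O hO).op f) '' Q

end

end HamiltonBianchi

end

/-! The image R of the order is a discrete cocompact subring of ℍ, stable under conjugation. Let E
be the sum of the norms of a ℤ-basis of R.

Reduction: Dirichlet's box principle (`exists_approx`) makes a form of discriminant Δ take a value
at most (4 + |Δ|)E² in absolute value at some nonzero vector of R × R (`exists_abs_toFun_le`). Such
a vector need not be a column of an element of SL₂(O). A shortest one is nevertheless the first
column of a matrix over R whose determinant is nonzero and bounded, again by Dirichlet
(`exists_dieudonneSq_le`). Substituting this matrix bounds the first coefficient and keeps the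
discriminant nonzero and bounded; a translation then bounds the other coefficients
(`exists_shear_bound`). So every f of discriminant Δ is carried into one finite set S by some
nonsingular g over R.

Descent to orbits: if f ∘ g = f' ∘ g' = s, comparing discriminants gives g and g' the same squared
Dieudonné determinant d, and h = g' g⁻¹ carries f' to f. Since g⁻¹ = d⁻¹ adj g, h is integral as
soon as adj g and adj g' agree modulo d, and h then has determinant 1 because Δ ≠ 0. Only finitely
many s and residues modulo d occur (`finite_orbits_of_comp_mem`). -/

noncomputable section

namespace HamiltonBianchi

/-! ### Orders as conjugation-stable lattices in ℍ -/

/-- An order contains a `ℤ`-basis of itself whose image in `ℍ` is a real basis of `ℍ`. -/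
theorem IsOrder.exists_basis {A : Type*} [Ring A] [Algebra ℚ A] {O : Subring A}
    (hO : IsOrder O) (ι : ℝ ⊗[ℚ] A ≃ₐ[ℝ] ℍ[ℝ]) :
    ∃ (n : ℕ) (e : Module.Basis (Fin n) ℝ ℍ[ℝ]),
      ∀ x, x ∈ imageInH ι O ↔ x ∈ Submodule.span ℤ (Set.range e) := by
  have htf : IsAddTorsionFree A := IsAddTorsionFree.of_module_rat A
  set L : Submodule ℤ A := AddSubgroup.toIntSubmodule O.toAddSubgroup with hL
  have hfg : L.FG := by
    have := hO.fg
    rw [← AddSubgroup.toIntSubmodule_toAddSubgroup O.toAddSubgroup] at this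
    exact (Submodule.fg_iff_addSubgroup_fg _).2 this
  have : Module.Finite ℤ L := Module.Finite.iff_fg.2 hfg
  have : Module.Free ℤ L := Module.free_of_finite_type_torsion_free'
  let b := Module.finBasis ℤ L
  set v : Fin (Module.finrank ℤ L) → A := fun i => (b i : A) with hv
  have hspan : Submodule.span ℤ (Set.range v) = L := by
    have := congrArg (Submodule.map L.subtype) b.span_eq
    rwa [Submodule.map_span, ← Set.range_comp, Submodule.map_top, Submodule.range_subtype] at this
  have hliZ : LinearIndependent ℤ v := b.linearIndependent.map' L.subtype L.ker_subtype
  -- Clearing denominators. The resulting ℚ-basis of `A` is then extended to ℝ ⊗ A and carried to ℍ.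
  have hliQ : LinearIndependent ℚ v := (LinearIndependent.iff_fractionRing ℤ ℚ).1 hliZ
  have htop : ⊤ ≤ Submodule.span ℚ (Set.range v) := by
    rw [← hO.span_eq_top, Submodule.span_le]
    intro z hz
    have hz' : z ∈ Submodule.span ℤ (Set.range v) := by rw [hspan]; exact hz
    exact Submodule.span_subset_span ℤ ℚ _ hz'
  let B := Module.Basis.mk hliQ htop
  let e := (B.baseChange ℝ).map ι.toLinearEquiv
  have he : ∀ i, e i = ι (1 ⊗ₜ v i) := fun i => by
    simp [e, B]
  refine ⟨_, e, fun x => ?_⟩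
  let F : A →ₗ[ℤ] ℍ[ℝ] := ((ι : ℝ ⊗[ℚ] A →+* ℍ[ℝ]).comp
      (Algebra.TensorProduct.includeRight : A →ₐ[ℚ] ℝ ⊗[ℚ] A).toRingHom).toIntAlgHom.toLinearMap
  have hF : ∀ y, F y = ι (1 ⊗ₜ y) := fun y => rfl
  have hr : Set.range e = F '' Set.range v := by
    rw [← Set.range_comp]
    congr 1
    funext i
    exact he i
  rw [hr, ← Submodule.map_span, hspan, mem_imageInH]
  rfl

/-- A subring of `ℍ` which is stable under conjugation and spanned over `ℤ` by the real basis `e`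
of `ℍ`. -/
structure IsStarLattice {I : Type*} (R : Subring ℍ[ℝ]) (e : Module.Basis I ℝ ℍ[ℝ]) : Prop where
  mem_iff : ∀ x, x ∈ R ↔ x ∈ Submodule.span ℤ (Set.range e)
  star_mem : ∀ x ∈ R, star x ∈ R

namespace IsStarLattice

variable {I : Type*} {R : Subring ℍ[ℝ]} {e : Module.Basis I ℝ ℍ[ℝ]}

theorem nrd_mem (hR : IsStarLattice R e) {x : ℍ[ℝ]} (hx : x ∈ R) : (nrd x : ℍ[ℝ]) ∈ R := by
  rw [coe_nrd]
  exact mul_mem hx (hR.star_mem x hx)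

variable [Fintype I]

theorem finite_norm_le (hR : IsStarLattice R e) (C : ℝ) : {x | x ∈ R ∧ ‖x‖ ≤ C}.Finite := by
  refine (ZSpan.setFinite_inter e (Metric.isBounded_closedBall (x := 0) (r := C))).subset ?_
  rintro x ⟨hx, hC⟩
  exact ⟨by simpa using hC, (hR.mem_iff x).1 hx⟩

/-- Rounding coordinates down. The bound serves twice: for representatives modulo a determinant, and
for the translation that reduces b. -/
theorem exists_norm_sub_le (hR : IsStarLattice R e) (z : ℍ[ℝ]) :
    ∃ r ∈ R, ‖z - r‖ ≤ ∑ i, ‖e i‖ :=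
  ⟨ZSpan.floor e z, (hR.mem_iff _).2 (ZSpan.floor e z).2, ZSpan.norm_fract_le e z⟩

/-- The real elements of `R` form a discrete set. -/
theorem one_le_abs (hR : IsStarLattice R e) {a : ℝ} (ha : (a : ℍ[ℝ]) ∈ R) (h0 : a ≠ 0) :
    1 ≤ |a| := by
  by_contra! h
  -- If 0 < |a| < 1, the powers of a would be infinitely many elements of R in the unit ball.
  have hinj : Function.Injective fun n : ℕ => ((a ^ n : ℝ) : ℍ[ℝ]) := by
    intro m n hmn
    have h1 : |a| ^ m = |a| ^ n := by
      rw [← abs_pow, ← abs_pow, Quaternion.coe_injective hmn]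
    exact (pow_right_strictAnti₀ (abs_pos.2 h0) h).injective h1
  refine Set.infinite_range_of_injective hinj ((hR.finite_norm_le 1).subset ?_)
  rintro _ ⟨n, rfl⟩
  refine ⟨by simpa using pow_mem ha n, ?_⟩
  simpa using pow_le_one₀ (abs_nonneg a) h.le

/-- The reduced norm is a nonzero real element of R, so `one_le_abs` applies to it. -/
theorem one_le_norm (hR : IsStarLattice R e) {x : ℍ[ℝ]} (hx : x ∈ R) (h0 : x ≠ 0) :
    1 ≤ ‖x‖ := by
  have h := hR.one_le_abs (hR.nrd_mem hx) (Quaternion.normSq_ne_zero.2 h0)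
  rw [nrd, Quaternion.normSq_eq_norm_mul_self, abs_mul_self] at h
  nlinarith [norm_nonneg x]

theorem sum_zsmul_mem (hR : IsStarLattice R e) (w : I → ℤ) : ∑ i, w i • e i ∈ R :=
  (hR.mem_iff _).2 (sum_mem fun i _ => Submodule.smul_mem _ _ (Submodule.subset_span ⟨i, rfl⟩))

/-! ### Dirichlet approximation -/

/-- Dirichlet's approximation theorem: every quaternion `β` is close to a fraction of elements
of `R`. -/
theorem exists_approx (hR : IsStarLattice R e) (β : ℍ[ℝ]) {Q : ℕ} (hQ : 0 < Q) :
    ∃ v ∈ R, v ≠ 0 ∧ ‖v‖ ≤ Q * ∑ i, ‖e i‖ ∧ ∃ u ∈ R, ‖u + β * v‖ ≤ (∑ i, ‖e i‖) / Q := by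
  classical
  have hQ' : (0 : ℝ) < Q := Nat.cast_pos.2 hQ
  -- Pigeonhole: the (Q+1)ⁿ combinations w with coefficients 0, …, Q are sorted by which of the Qⁿ
  -- boxes of side 1/Q contains the fractional part of β · P w. Then v is the difference of two
  -- combinations in one box.
  let P : (I → Fin (Q + 1)) → ℍ[ℝ] := fun w => ∑ i, ((w i : ℕ) : ℤ) • e i
  let box : (I → Fin (Q + 1)) → I → Fin Q := fun w i =>
    ⟨⌊Q * Int.fract (e.repr (β * P w) i)⌋₊, by
      rw [Nat.floor_lt (mul_nonneg hQ'.le (Int.fract_nonneg _))]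
      exact (mul_lt_iff_lt_one_right hQ').2 (Int.fract_lt_one _)⟩
  have hI : Nonempty I := by
    by_contra h
    rw [not_nonempty_iff] at h
    have h1 := e.ext_elem (x := 1) (y := 0) (fun i => h.elim i)
    exact one_ne_zero h1
  have hcard : Fintype.card (I → Fin Q) < Fintype.card (I → Fin (Q + 1)) := by
    simp only [Fintype.card_fun, Fintype.card_fin]
    exact Nat.pow_lt_pow_left (Nat.lt_succ_self Q) Fintype.card_ne_zero
  obtain ⟨w, w', hne, hbox⟩ := Fintype.exists_ne_map_eq_of_card_lt box hcard
  have hsub : P w - P w' = ∑ i, (((w i : ℕ) : ℤ) - ((w' i : ℕ) : ℤ)) • e i := by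
    simp only [P, ← Finset.sum_sub_distrib, sub_smul]
  have hv : P w - P w' ∈ R := hsub ▸ hR.sum_zsmul_mem _
  refine ⟨P w - P w', hv, ?_, ?_, ?_⟩
  · intro h0
    apply hne
    have hli : LinearIndependent ℤ e := e.linearIndependent.restrict_scalars' ℤ
    rw [hsub] at h0
    have := Fintype.linearIndependent_iff.1 hli _ h0
    funext i
    have := this i
    ext
    omega
  · rw [hsub, Finset.mul_sum]
    refine norm_sum_le_of_le _ fun i _ => ?_
    rw [← Int.cast_smul_eq_zsmul ℝ, norm_smul]
    gcongr
    have h1 : ((w i : ℕ) : ℝ) ≤ Q := by exact_mod_cast Nat.lt_succ_iff.1 (w i).2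
    have h2 : ((w' i : ℕ) : ℝ) ≤ Q := by exact_mod_cast Nat.lt_succ_iff.1 (w' i).2
    rw [Real.norm_eq_abs, abs_le]
    push_cast
    constructor <;> linarith [Nat.cast_nonneg (α := ℝ) (w i : ℕ), Nat.cast_nonneg (α := ℝ) (w' i : ℕ)]
  -- Taking u as the difference of the integral parts leaves in u + βv only the difference of two
  -- fractional parts from one box.
  · let k : I → ℤ := fun i => ⌊e.repr (β * P w') i⌋ - ⌊e.repr (β * P w) i⌋
    refine ⟨_, hR.sum_zsmul_mem k, ?_⟩
    have hsum : ∑ i, k i • e i + β * (P w - P w')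
        = ∑ i, (Int.fract (e.repr (β * P w) i) - Int.fract (e.repr (β * P w') i)) • e i := by
      rw [mul_sub, ← e.sum_repr (β * P w), ← e.sum_repr (β * P w'), ← Finset.sum_sub_distrib,
        ← Finset.sum_add_distrib]
      refine Finset.sum_congr rfl fun i _ => ?_
      rw [← Int.cast_smul_eq_zsmul ℝ, ← sub_smul, ← add_smul, e.sum_repr, e.sum_repr, Int.fract,
        Int.fract]
      congr 1
      simp only [k]
      push_cast
      ring
    rw [hsum, Finset.sum_div]
    refine norm_sum_le_of_le _ fun i _ => ?_
    have hi : ⌊Q * Int.fract (e.repr (β * P w) i)⌋₊ = ⌊Q * Int.fract (e.repr (β * P w') i)⌋₊ :=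
      congrArg (fun b => (b i : ℕ)) hbox
    have h1 := Nat.floor_le (mul_nonneg hQ'.le (Int.fract_nonneg (e.repr (β * P w) i)))
    have h2 := Nat.lt_floor_add_one (Q * Int.fract (e.repr (β * P w) i))
    have h3 := Nat.floor_le (mul_nonneg hQ'.le (Int.fract_nonneg (e.repr (β * P w') i)))
    have h4 := Nat.lt_floor_add_one (Q * Int.fract (e.repr (β * P w') i))
    rw [hi] at h1 h2
    rw [norm_smul, div_eq_inv_mul, Real.norm_eq_abs]
    gcongr
    rw [← mul_le_mul_iff_right₀ hQ', mul_inv_cancel₀ hQ'.ne']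
    nth_rw 1 [← abs_of_pos hQ']
    rw [← abs_mul, abs_le, mul_sub]
    constructor <;> linarith

end IsStarLattice

/-! ### Adjugates and integral substitutions -/

/-- The computation of `mul_adj` without normalizing the determinant; the reducing matrices are only
nonsingular. -/
theorem mul_adj_eq_smul (g : Matrix (Fin 2) (Fin 2) ℍ[ℝ]) : g * adj g = dieudonneSq g • 1 := by
  have hg' : (dieudonneSq g : ℍ[ℝ]) = dieudonneSq g • 1 := by
    rw [← Quaternion.coe_mul_eq_smul, mul_one]
  conv_lhs at hg' =>
    simp only [dieudonneSq, Quaternion.coe_add, Quaternion.coe_sub, coe_tr, map_mul, nrd,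
      Quaternion.coe_mul, star_mul, star_star, Quaternion.coe_mul_eq_smul]
  have h3 : ∀ q r : ℍ[ℝ], q * (star q * r) = Quaternion.normSq q • r := fun q r => by
    rw [← mul_assoc q, Quaternion.self_mul_star, Quaternion.coe_mul_eq_smul]
  have h4 : ∀ q : ℍ[ℝ], q * star q = Quaternion.normSq q • 1 := fun q => by
    rw [Quaternion.self_mul_star, ← Quaternion.coe_mul_eq_smul, mul_one]
  have h5 : ∀ r : ℝ, (r : ℍ[ℝ]) = r • 1 := fun r => by
    rw [← Quaternion.coe_mul_eq_smul, mul_one]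
  simp only [mul_assoc, h5, smul_smul] at hg'
  apply Matrix.ext
  intro i j
  fin_cases i <;> fin_cases j <;>
    simp [adj, Matrix.mul_apply, Fin.sum_univ_two, mul_sub, mul_assoc, h3, h4, smul_smul]
  · rw [mul_comm (Quaternion.normSq (g 1 1)), mul_comm (Quaternion.normSq (g 1 0))]
    refine Eq.trans ?_ hg'
    abel
  · have hcomm : g 0 0 * (star (g 1 0) * (g 1 1 * star (g 0 1)))
        + g 0 1 * (star (g 1 1) * (g 1 0 * star (g 0 0)))
        = g 1 1 * (star (g 0 1) * (g 0 0 * star (g 1 0)))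
        + g 1 0 * (star (g 0 0) * (g 0 1 * star (g 1 1))) := by
      have h6 := coe_tr (g 0 0 * star (g 1 0) * (g 1 1 * star (g 0 1)))
      have h7 := coe_tr (g 1 1 * star (g 0 1) * (g 0 0 * star (g 1 0)))
      rw [tr, re_mul_comm, ← tr, h7] at h6
      simpa [mul_assoc] using h6.symm
    rw [hcomm] at hg'
    refine Eq.trans ?_ hg'
    abel

theorem inv_smul_adj_mul_self {g : Matrix (Fin 2) (Fin 2) ℍ[ℝ]} (hg : dieudonneSq g ≠ 0) :
    ((dieudonneSq g)⁻¹ • adj g) * g = 1 := by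
  rw [mul_eq_one_comm, Matrix.mul_smul, mul_adj_eq_smul, smul_smul, inv_mul_cancel₀ hg, one_smul]

theorem adj_apply_mem {R : Subring ℍ[ℝ]} (hR : ∀ x ∈ R, star x ∈ R)
    {g : Matrix (Fin 2) (Fin 2) ℍ[ℝ]} (hg : ∀ i j, g i j ∈ R) (i j : Fin 2) : adj g i j ∈ R := by
  have hs : ∀ i j, star (g i j) ∈ R := fun i j => hR _ (hg i j)
  have key : ∀ i j k l m n p q r s t u, g i j * star (g k l) * star (g m n)
      - star (g p q) * g r s * star (g t u) ∈ R :=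
    fun i j k l m n p q r s t u =>
      sub_mem (mul_mem (mul_mem (hg _ _) (hs _ _)) (hs _ _))
        (mul_mem (mul_mem (hs _ _) (hg _ _)) (hs _ _))
  fin_cases i <;> fin_cases j <;> exact key _ _ _ _ _ _ _ _ _ _ _ _

namespace BinaryHamiltonianForm

theorem comp_mul (f : BinaryHamiltonianForm) (g h : Matrix (Fin 2) (Fin 2) ℍ[ℝ]) :
    f.comp (g * h) = (f.comp g).comp h := by
  apply toFun_injective
  funext X
  simp [toFun_comp, matMul_mul]

theorem comp_one (f : BinaryHamiltonianForm) : f.comp 1 = f := by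
  apply toFun_injective
  funext X
  simp [toFun_comp, matMul_one]

/-- The values of an integral form at vectors with entries in the subring lie in the subring. -/
theorem coe_toFun_mem {R : Subring ℍ[ℝ]} (hR : ∀ x ∈ R, star x ∈ R) {f : BinaryHamiltonianForm}
    (hf : f.IsIntegralOver R) {X : ℍ[ℝ] × ℍ[ℝ]} (h1 : X.1 ∈ R) (h2 : X.2 ∈ R) :
    (f.toFun X : ℍ[ℝ]) ∈ R := by
  obtain ⟨ha, hb, hc⟩ := hf
  rw [coe_toFun]
  exact add_mem (add_mem (add_mem (mul_mem (mul_mem (hR _ h1) ha) h1)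
    (mul_mem (mul_mem (hR _ h1) hb) h2)) (mul_mem (mul_mem (hR _ h2) (hR _ hb)) h1))
    (mul_mem (mul_mem (hR _ h2) hc) h2)

theorem IsIntegralOver.comp {R : Subring ℍ[ℝ]} (hR : ∀ x ∈ R, star x ∈ R)
    {f : BinaryHamiltonianForm} (hf : f.IsIntegralOver R) {g : Matrix (Fin 2) (Fin 2) ℍ[ℝ]}
    (hg : ∀ i j, g i j ∈ R) : (f.comp g).IsIntegralOver R := by
  refine ⟨coe_toFun_mem hR hf (hg _ _) (hg _ _), ?_, coe_toFun_mem hR hf (hg _ _) (hg _ _)⟩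
  obtain ⟨ha, hb, hc⟩ := hf
  have hs := fun i j => hR _ (hg i j)
  exact add_mem (add_mem (add_mem (mul_mem (mul_mem (hs _ _) ha) (hg _ _))
    (mul_mem (mul_mem (hs _ _) hb) (hg _ _))) (mul_mem (mul_mem (hs _ _) (hR _ hb)) (hg _ _)))
    (mul_mem (mul_mem (hs _ _) hc) (hg _ _))

end BinaryHamiltonianForm

open BinaryHamiltonianForm

/-! ### From nonsingular substitutions to orbits -/

section

variable {A : Type*} [Ring A] [Algebra ℚ A] {ι : ℝ ⊗[ℚ] A ≃ₐ[ℝ] ℍ[ℝ]} {O : Subring A}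

/-- The determinant condition is automatic: the substitution multiplies the discriminant by
`dieudonneSq h`, and both discriminants equal Δ ≠ 0. -/
theorem orbit_eq_of_comp_eq (hO : IsOrder O) {Δ : ℤ} (hΔ : Δ ≠ 0) {f f' : BinaryHamiltonianForm}
    (hf : f.disc = Δ) (hf' : f'.disc = Δ) {h k : Matrix (Fin 2) (Fin 2) ℍ[ℝ]}
    (hh : ∀ i j, h i j ∈ imageInH ι O) (hhk : h * k = 1) (hcomp : f'.comp h = f) :
    MulAction.orbit (SL2O ι O hO).op f = MulAction.orbit (SL2O ι O hO).op f' := by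
  have hdet : dieudonneSq h = 1 := by
    have := disc_comp f' h
    rw [hcomp, hf, hf'] at this
    have hΔ' : (Δ : ℝ) ≠ 0 := Int.cast_ne_zero.2 hΔ
    exact (mul_right_cancel₀ hΔ' (by rw [one_mul]; exact this)).symm
  let u : (Matrix (Fin 2) (Fin 2) ℍ[ℝ])ˣ := ⟨h, k, hhk, mul_eq_one_comm.1 hhk⟩
  have hu : u ∈ SL2O ι O hO := ⟨mem_SL2H.2 (dieudonneDet_eq_one_iff.2 hdet), hh⟩
  rw [MulAction.orbit_eq_iff]
  exact ⟨⟨MulOpposite.op u, hu⟩, hcomp⟩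

/-- If every form of a given nonzero discriminant can be brought into a finite set by a nonsingular
substitution with entries in `O`, then the forms fall into finitely many orbits. -/
theorem finite_orbits_of_comp_mem (hO : IsOrder O) {I : Type*} [Fintype I]
    {e : Module.Basis I ℝ ℍ[ℝ]} (hR : IsStarLattice (imageInH ι O) e) {Δ : ℤ} (hΔ : Δ ≠ 0)
    {Q S : Set BinaryHamiltonianForm} (hS : S.Finite) (hQ : ∀ f ∈ Q, f.disc = Δ)
    (H : ∀ f ∈ Q, ∃ g : Matrix (Fin 2) (Fin 2) ℍ[ℝ], (∀ i j, g i j ∈ imageInH ι O) ∧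
      dieudonneSq g ≠ 0 ∧ f.comp g ∈ S) :
    (orbits ι O hO Q).Finite := by
  have hΔ' : (Δ : ℝ) ≠ 0 := Int.cast_ne_zero.2 hΔ
  set R := imageInH ι O with hRdef
  -- A finite set containing representatives of all residues modulo d that are needed.
  let T : ℝ → Set (Matrix (Fin 2) (Fin 2) ℍ[ℝ]) := fun d =>
    {G | ∀ i j, G i j ∈ {x | x ∈ R ∧ ‖x‖ ≤ |d| * ∑ i, ‖e i‖}}
  have hT : ∀ d, (T d).Finite := fun d =>
    Set.Finite.pi' fun _ => Set.Finite.pi' fun _ => hR.finite_norm_le _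
  -- forms reduced to `s` by a substitution whose adjugate is congruent to `G`
  let D : BinaryHamiltonianForm → Matrix (Fin 2) (Fin 2) ℍ[ℝ] → Set BinaryHamiltonianForm :=
    fun s G => {f | f ∈ Q ∧ ∃ g E : Matrix (Fin 2) (Fin 2) ℍ[ℝ], (∀ i j, g i j ∈ R) ∧
      (∀ i j, E i j ∈ R) ∧ dieudonneSq g ≠ 0 ∧ f.comp g = s ∧ adj g = G + dieudonneSq g • E}
  have hsub : ∀ s G, ((fun f => MulAction.orbit (SL2O ι O hO).op f) '' D s G).Subsingleton := by
    rintro s G _ ⟨f, ⟨hf, g, E, hg, hE, hd, hs, hG⟩, rfl⟩ _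
      ⟨f', ⟨hf', g', E', hg', hE', hd', hs', hG'⟩, rfl⟩
    have hdd : dieudonneSq g' = dieudonneSq g := by
      have h1 := disc_comp f g
      have h2 := disc_comp f' g'
      rw [hs, hQ f hf] at h1
      rw [hs', hQ f' hf', h1] at h2
      exact (mul_right_cancel₀ hΔ' h2).symm
    have e1 := inv_smul_adj_mul_self hd
    have e2 := inv_smul_adj_mul_self hd'
    have e1' := mul_eq_one_comm.1 e1
    have e2' := mul_eq_one_comm.1 e2
    -- This is g' g⁻¹. The common residue G cancels, which makes it visibly integral.
    have hval : g' * ((dieudonneSq g)⁻¹ • adj g) = 1 + g' * (E - E') := by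
      have h3 : (dieudonneSq g)⁻¹ • adj g = (dieudonneSq g')⁻¹ • adj g' + (E - E') := by
        rw [hG, hG', hdd, smul_add, smul_add, smul_smul, smul_smul, inv_mul_cancel₀ hd, one_smul,
          one_smul]
        abel
      rw [h3, mul_add, e2']
    refine orbit_eq_of_comp_eq hO hΔ (hQ f hf) (hQ f' hf')
      (h := g' * ((dieudonneSq g)⁻¹ • adj g)) (k := g * ((dieudonneSq g')⁻¹ • adj g')) ?_ ?_ ?_
    · intro i j
      rw [hval, Matrix.add_apply, Matrix.mul_apply, Matrix.one_apply]
      refine add_mem ?_ (sum_mem fun k _ => mul_mem (hg' _ _) (sub_mem (hE _ _) (hE' _ _)))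
      split
      · exact one_mem _
      · exact zero_mem _
    · rw [mul_assoc, ← mul_assoc _ g, e1, one_mul, e2']
    · rw [comp_mul, hs', ← hs, ← comp_mul, e1', comp_one]
  refine (hS.biUnion fun s _ => (hT (s.disc / Δ)).biUnion fun G _ =>
    (hsub s G).finite).subset ?_
  rintro _ ⟨f, hf, rfl⟩
  obtain ⟨g, hg, hd, hs⟩ := H f hf
  have hdisc : (f.comp g).disc / Δ = dieudonneSq g := by
    rw [disc_comp, hQ f hf, mul_div_cancel_right₀ _ hΔ']
  -- Rounding d⁻¹ adj g to E leaves adj g − dE as a representative of size at most |d| times the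
  -- rounding error.
  choose E hE hEle using fun i j => hR.exists_norm_sub_le ((dieudonneSq g)⁻¹ • adj g i j)
  have hdE : dieudonneSq g • Matrix.of E = Matrix.of fun i j => dieudonneSq g • E i j := rfl
  have hdmem : (dieudonneSq g : ℍ[ℝ]) ∈ R := by
    have h1 := mul_adj_eq_smul g
    have h2 := congrFun (congrFun h1 0) 0
    rw [Matrix.smul_apply, Matrix.one_apply_eq, ← Quaternion.coe_mul_eq_smul, mul_one] at h2
    rw [← h2, Matrix.mul_apply]
    exact sum_mem fun k _ => mul_mem (hg _ _) (adj_apply_mem hR.star_mem hg _ _)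
  simp only [Set.mem_iUnion]
  refine ⟨f.comp g, hs, adj g - dieudonneSq g • Matrix.of E, ?_, f,
    ⟨hf, g, Matrix.of E, hg, hE, hd, rfl, by abel⟩, rfl⟩
  intro i j
  constructor
  · rw [Matrix.sub_apply, Matrix.smul_apply, ← Quaternion.coe_mul_eq_smul]
    exact sub_mem (adj_apply_mem hR.star_mem hg _ _) (mul_mem hdmem (hE _ _))
  · rw [hdisc]
    have : (adj g - dieudonneSq g • Matrix.of E) i j
        = dieudonneSq g • ((dieudonneSq g)⁻¹ • adj g i j - E i j) := by
      rw [smul_sub, smul_smul, mul_inv_cancel₀ hd, one_smul]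
      rfl
    rw [this, norm_smul, Real.norm_eq_abs]
    gcongr
    exact hEle i j

end

/-! ### Identities for the reduction of forms -/

theorem nrd_eq_norm_sq (x : ℍ[ℝ]) : nrd x = ‖x‖ ^ 2 := by
  rw [nrd, Quaternion.normSq_eq_norm_mul_self, sq]

namespace BinaryHamiltonianForm

/-- Completing the square. -/
theorem a_mul_toFun (f : BinaryHamiltonianForm) (u v : ℍ[ℝ]) :
    f.a * f.toFun (u, v) = nrd (f.a • u + f.b * v) - f.disc * nrd v := by
  have h : (u * (star v * star f.b)).re = (star u * f.b * v).re := by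
    rw [← Quaternion.re_star, re_mul_comm (star u * f.b), ← mul_assoc v, re_mul_comm]
    simp only [star_mul, star_star, mul_assoc]
  simp only [toFun, disc, tr, nrd, Quaternion.normSq_add, Quaternion.normSq_smul, map_mul, star_mul,
    smul_mul_assoc, Quaternion.re_smul, smul_eq_mul, h]
  ring

theorem toFun_mul_right (f : BinaryHamiltonianForm) (u v l : ℍ[ℝ]) :
    f.toFun (u * l, v * l) = nrd l * f.toFun (u, v) := by
  have h : (star l * (star u * f.b * v) * l).re = nrd l * (star u * f.b * v).re :=
    re_star_mul_mul _ _
  simp only [toFun, tr, nrd, map_mul, star_mul, mul_assoc] at h ⊢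
  rw [h]
  ring

theorem finite_integral_bounded {I : Type*} [Fintype I] {R : Subring ℍ[ℝ]}
    {e : Module.Basis I ℝ ℍ[ℝ]} (hR : IsStarLattice R e) (K : ℝ) :
    {f : BinaryHamiltonianForm | f.IsIntegralOver R ∧ |f.a| ≤ K ∧ ‖f.b‖ ≤ K ∧ |f.c| ≤ K}.Finite := by
  have hB := hR.finite_norm_le K
  refine Set.Finite.of_finite_image (f := fun f => ((f.a : ℍ[ℝ]), f.b, (f.c : ℍ[ℝ])))
    ((hB.prod (hB.prod hB)).subset ?_) ?_
  · rintro _ ⟨f, ⟨⟨ha, hb, hc⟩, ha', hb', hc'⟩, rfl⟩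
    refine ⟨⟨ha, ?_⟩, ⟨hb, hb'⟩, hc, ?_⟩
    · simpa using ha'
    · simpa using hc'
  · rintro f - g - h
    simp only [Prod.mk.injEq] at h
    exact BinaryHamiltonianForm.ext (Quaternion.coe_injective h.1) h.2.1
      (Quaternion.coe_injective h.2.2)

end BinaryHamiltonianForm

/-- Schur complement: a row operation clears q below the pivot p. Bounding the determinant becomes
the problem of approximating q p⁻¹ v by u. -/
theorem dieudonneSq_eq_of_ne_zero {p : ℍ[ℝ]} (hp : p ≠ 0) (q u v : ℍ[ℝ]) :
    dieudonneSq !![p, v; q, u] = nrd p * nrd (u + -(q * p⁻¹) * v) := by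
  have h1 : (u * star (q * p⁻¹ * v)).re * nrd p = (p * star q * u * star v).re := by
    have h2 : star p⁻¹ = (nrd p)⁻¹ • p := by
      rw [Quaternion.inv_def, Quaternion.star_smul, star_star]
    rw [star_mul, star_mul, h2]
    simp only [smul_mul_assoc, mul_smul_comm, Quaternion.re_smul, smul_eq_mul]
    rw [← mul_assoc u, re_mul_comm (u * star v), mul_comm, ← mul_assoc,
      mul_inv_cancel₀ (Quaternion.normSq_ne_zero.2 hp), one_mul]
    simp only [mul_assoc]
  have hp' : Quaternion.normSq p ≠ 0 := Quaternion.normSq_ne_zero.2 hp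
  simp only [dieudonneSq, Matrix.of_apply, Matrix.cons_val', Matrix.cons_val_zero,
    Matrix.cons_val_one, Matrix.cons_val_fin_one, nrd, tr, ← h1, neg_mul,
    map_mul, map_inv₀, Quaternion.normSq_neg, Quaternion.normSq_add,
    star_neg, mul_neg, Quaternion.re_neg]
  field_simp
  ring

/-! ### Reduction to bounded coefficients -/

namespace IsStarLattice

variable {I : Type*} [Fintype I] {R : Subring ℍ[ℝ]} {e : Module.Basis I ℝ ℍ[ℝ]}

/-- Dirichlet with Q = 1 produces a nonzero element of norm at most the sum, while nonzero elements
have norm at least 1. -/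
theorem one_le_sum_norm (hR : IsStarLattice R e) : 1 ≤ ∑ i, ‖e i‖ := by
  obtain ⟨v, hv, h0, hle, -⟩ := hR.exists_approx 0 one_pos
  have := hR.one_le_norm hv h0
  rw [Nat.cast_one, one_mul] at hle
  linarith

/-- An integral form takes a small value at a nonzero vector of the lattice `R × R`. -/
theorem exists_abs_toFun_le (hR : IsStarLattice R e) (f : BinaryHamiltonianForm) :
    ∃ u ∈ R, ∃ v ∈ R, (u ≠ 0 ∨ v ≠ 0) ∧
      |f.toFun (u, v)| ≤ (4 + |f.disc|) * (∑ i, ‖e i‖) ^ 2 := by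
  have hE := hR.one_le_sum_norm
  set E := ∑ i, ‖e i‖
  have hE2 : 1 ≤ E ^ 2 := one_le_pow₀ hE
  rcases le_or_gt |f.a| 1 with ha | ha
  · refine ⟨1, one_mem _, 0, zero_mem _, Or.inl one_ne_zero, ?_⟩
    have : f.toFun (1, 0) = f.a := by simp [toFun, tr]
    rw [this]
    nlinarith [abs_nonneg f.disc]
  · have ha0 : f.a ≠ 0 := by
      intro h
      rw [h, abs_zero] at ha
      linarith
    -- In a · f(u, v) = n(au + bv) − Δ n(v) the terms are at most a²E²/Q² and |Δ|Q²E². The choice Q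
    -- = ⌊√|a|⌋ makes both O(|a|); the factor 4 comes from √|a| < Q + 1 ≤ 2Q.
    set s := √|f.a|
    have hs : s ^ 2 = |f.a| := Real.sq_sqrt (abs_nonneg _)
    have hs0 : 0 ≤ s := Real.sqrt_nonneg _
    have hs1 : 1 ≤ s := by nlinarith
    have hQ : 0 < ⌊s⌋₊ := Nat.floor_pos.2 hs1
    obtain ⟨v, hv, hv0, hvle, u, hu, hule⟩ := hR.exists_approx (f.a⁻¹ • f.b) hQ
    refine ⟨u, hu, v, hv, Or.inr hv0, ?_⟩
    have hQ1 : (1 : ℝ) ≤ ⌊s⌋₊ := by exact_mod_cast hQ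
    have hQs : (⌊s⌋₊ : ℝ) ≤ s := Nat.floor_le hs0
    have hsQ : s < ⌊s⌋₊ + 1 := Nat.lt_floor_add_one s
    set Q : ℝ := (⌊s⌋₊ : ℝ)
    have h1 : f.a • u + f.b * v = f.a • (u + f.a⁻¹ • f.b * v) := by
      rw [smul_add, smul_mul_assoc, smul_smul, mul_inv_cancel₀ ha0, one_smul]
    have h2 := f.a_mul_toFun u v
    rw [h1, nrd_eq_norm_sq, nrd_eq_norm_sq, norm_smul, Real.norm_eq_abs] at h2
    have h3 : |f.a| * |f.toFun (u, v)| ≤ (|f.a| * (E / Q)) ^ 2 + |f.disc| * (Q * E) ^ 2 := by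
      rw [← abs_mul, h2]
      refine (abs_sub _ _).trans ?_
      rw [abs_mul f.disc, abs_of_nonneg (sq_nonneg (|f.a| * _)), abs_of_nonneg (sq_nonneg ‖v‖)]
      gcongr
    have h4 : (|f.a| * (E / Q)) ^ 2 ≤ |f.a| * (4 * E ^ 2) := by
      have h5 : s ^ 2 ≤ 4 * Q ^ 2 := by nlinarith
      have h6 : (|f.a| * (E / Q)) ^ 2 = |f.a| * (s ^ 2 * (E ^ 2 / Q ^ 2)) := by rw [hs]; ring
      rw [h6]
      refine mul_le_mul_of_nonneg_left ?_ (abs_nonneg _)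
      calc s ^ 2 * (E ^ 2 / Q ^ 2) ≤ 4 * Q ^ 2 * (E ^ 2 / Q ^ 2) := by gcongr
        _ = 4 * E ^ 2 := by field_simp
    have h7 : |f.disc| * (Q * E) ^ 2 ≤ |f.a| * (|f.disc| * E ^ 2) := by
      have h8 : Q ^ 2 ≤ |f.a| := by rw [← hs]; gcongr
      calc |f.disc| * (Q * E) ^ 2 = Q ^ 2 * (|f.disc| * E ^ 2) := by ring
        _ ≤ _ := by gcongr
    refine le_of_mul_le_mul_left ?_ (zero_lt_one.trans ha)
    linarith

/-- A vector of `R × R` which is minimal in its line can be completed to a matrix of bounded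
determinant. -/
theorem exists_dieudonneSq_le (hR : IsStarLattice R e) {p q : ℍ[ℝ]} (hp0 : p ≠ 0)
    (hmin : ∀ l, p * l ∈ R → q * l ∈ R → l ≠ 0 → 1 ≤ ‖l‖) :
    ∃ v ∈ R, ∃ u ∈ R, dieudonneSq !![p, v; q, u] ≠ 0 ∧
      |dieudonneSq !![p, v; q, u]| ≤ 4 * (∑ i, ‖e i‖) ^ 4 := by
  have hE := hR.one_le_sum_norm
  set E := ∑ i, ‖e i‖ with hEdef
  have hE0 : 0 < E := zero_lt_one.trans_le hE
  have hnp : 0 < ‖p‖ := norm_pos_iff.2 hp0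
  have hE4 : E ^ 2 ≤ E ^ 4 := pow_le_pow_right₀ hE (by norm_num)
  rcases le_or_gt ‖p‖ E with hpE | hpE
  · refine ⟨0, zero_mem _, 1, one_mem _, ?_⟩
    rw [dieudonneSq_eq_of_ne_zero hp0, mul_zero, add_zero, nrd_eq_norm_sq, nrd_eq_norm_sq, norm_one,
      one_pow, mul_one, abs_of_nonneg (sq_nonneg _)]
    refine ⟨(pow_pos hnp 2).ne', ?_⟩
    have : ‖p‖ ^ 2 ≤ E ^ 2 := by gcongr
    nlinarith
  -- Q is the largest integer with QE < ‖p‖. Strictness gives ‖v‖ < ‖p‖, hence a nonzero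
  -- determinant; ‖p‖ ≤ (Q + 1)E ≤ 2QE bounds it.
  · obtain ⟨Q, hQ⟩ : ∃ Q, ⌈‖p‖ / E⌉₊ = Q + 1 :=
      Nat.exists_eq_succ_of_ne_zero (Nat.ceil_pos.2 (by positivity)).ne'
    have hpos : 1 < ‖p‖ / E := (one_lt_div hE0).2 hpE
    have h1 : ‖p‖ / E ≤ Q + 1 := by
      have := Nat.le_ceil (‖p‖ / E)
      rw [hQ] at this
      exact_mod_cast this
    have h2 : (Q : ℝ) < ‖p‖ / E := Nat.lt_ceil.1 (by omega)
    have hQ0 : 0 < Q := by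
      rcases Nat.eq_zero_or_pos Q with rfl | h
      · norm_num at h1
        linarith
      · exact h
    have hQ1 : (1 : ℝ) ≤ Q := by exact_mod_cast hQ0
    rw [div_le_iff₀ hE0] at h1
    rw [lt_div_iff₀ hE0] at h2
    obtain ⟨v, hv, hv0, hvle, u, hu, hule⟩ := hR.exists_approx (-(q * p⁻¹)) hQ0
    refine ⟨v, hv, u, hu, ?_⟩
    rw [dieudonneSq_eq_of_ne_zero hp0, nrd_eq_norm_sq, nrd_eq_norm_sq, ← mul_pow,
      abs_of_nonneg (sq_nonneg _)]
    constructor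
    · refine pow_ne_zero 2 (mul_ne_zero hnp.ne' (norm_ne_zero_iff.2 fun h => ?_))
      -- A zero determinant would make (v, u) = (p, q) · l with l = p⁻¹v and ‖l‖ < 1, against
      -- minimality.
      have hul : u = q * (p⁻¹ * v) := by
        rw [neg_mul, ← sub_eq_add_neg, sub_eq_zero] at h
        rw [h, mul_assoc]
      have hvl : v = p * (p⁻¹ * v) := by rw [mul_inv_cancel_left₀ hp0]
      have := hmin (p⁻¹ * v) (hvl ▸ hv) (hul ▸ hu) (mul_ne_zero (inv_ne_zero hp0) hv0)
      rw [norm_mul, norm_inv, inv_mul_eq_div, one_le_div hnp] at this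
      linarith
    · have h3 : ‖p‖ * ‖u + -(q * p⁻¹) * v‖ ≤ 2 * E ^ 2 := by
        calc ‖p‖ * ‖u + -(q * p⁻¹) * v‖ ≤ (2 * Q * E) * (E / Q) := by
              gcongr
              nlinarith
          _ = 2 * E ^ 2 := by field_simp
      calc _ ≤ (2 * E ^ 2) ^ 2 := by gcongr
        _ = 4 * E ^ 4 := by ring

/-- Every form is transformed by a matrix of bounded determinant into one whose first coefficient
is small. -/
theorem exists_comp_a_le (hR : IsStarLattice R e) (f : BinaryHamiltonianForm) :
    ∃ g : Matrix (Fin 2) (Fin 2) ℍ[ℝ], (∀ i j, g i j ∈ R) ∧ dieudonneSq g ≠ 0 ∧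
      |dieudonneSq g| ≤ 4 * (∑ i, ‖e i‖) ^ 4 ∧
      |(f.comp g).a| ≤ (4 + |f.disc|) * (∑ i, ‖e i‖) ^ 2 := by
  have hE := hR.one_le_sum_norm
  set C := (4 + |f.disc|) * (∑ i, ‖e i‖) ^ 2 with hC
  let N : ℍ[ℝ] × ℍ[ℝ] → ℝ := fun X => ‖X.1‖ ^ 2 + ‖X.2‖ ^ 2
  let Y : Set (ℍ[ℝ] × ℍ[ℝ]) := {X | X.1 ∈ R ∧ X.2 ∈ R ∧ (X.1 ≠ 0 ∨ X.2 ≠ 0) ∧ |f.toFun X| ≤ C}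
  obtain ⟨⟨p, q⟩, ⟨hp, hq, h0, hle⟩, hmin⟩ : ∃ X ∈ Y, ∀ X' ∈ Y, N X ≤ N X' := by
    obtain ⟨u, hu, v, hv, h0, hle⟩ := hR.exists_abs_toFun_le f
    have hfin : {X | X ∈ Y ∧ N X ≤ N (u, v)}.Finite := by
      have hB := hR.finite_norm_le √(N (u, v))
      refine (hB.prod hB).subset ?_
      rintro X ⟨⟨h1, h2, -⟩, hN⟩
      refine ⟨⟨h1, Real.le_sqrt_of_sq_le ?_⟩, h2, Real.le_sqrt_of_sq_le ?_⟩
      · exact (le_add_of_nonneg_right (sq_nonneg _)).trans hN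
      · exact (le_add_of_nonneg_left (sq_nonneg _)).trans hN
    obtain ⟨X, ⟨hX, hXN⟩, hX'⟩ := Set.exists_min_image _ N hfin ⟨(u, v), ⟨hu, hv, h0, hle⟩, le_rfl⟩
    refine ⟨X, hX, fun X' hY => ?_⟩
    rcases le_total (N X') (N (u, v)) with h | h
    · exact hX' X' ⟨hY, h⟩
    · exact hXN.trans h
  -- Right multiplication by l with ‖l‖ < 1 does not increase |f| and strictly shortens the vector.
  have hmin' : ∀ l, p * l ∈ R → q * l ∈ R → l ≠ 0 → 1 ≤ ‖l‖ := by
    intro l hpl hql hl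
    by_contra! hlt
    have hl1 : ‖l‖ ^ 2 < 1 := pow_lt_one₀ (norm_nonneg _) hlt two_ne_zero
    have h1 := hmin (p * l, q * l) ⟨hpl, hql, h0.imp (mul_ne_zero · hl) (mul_ne_zero · hl), by
      rw [f.toFun_mul_right, nrd_eq_norm_sq, abs_mul, abs_of_nonneg (sq_nonneg _)]
      exact (mul_le_of_le_one_left (abs_nonneg _) hl1.le).trans hle⟩
    have h2 : N (p * l, q * l) = ‖l‖ ^ 2 * N (p, q) := by
      simp only [N, norm_mul]
      ring
    have h3 : 0 < N (p, q) := by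
      rcases h0 with h | h
      · have := norm_pos_iff.2 h
        simp only [N]
        positivity
      · have := norm_pos_iff.2 h
        simp only [N]
        positivity
    rw [h2] at h1
    nlinarith
  -- With no pivot, compare (0, q) with (0, 1): its value is no larger since ‖q‖ ≥ 1, so minimality
  -- forces ‖q‖ = 1.
  by_cases hp0 : p = 0
  · subst hp0
    have hq0 : q ≠ 0 := by simpa using h0
    have hq1 := hR.one_le_norm hq hq0
    have h1 := hmin (0, 1) ⟨zero_mem _, one_mem _, Or.inr one_ne_zero, by
      refine le_trans ?_ hle
      have := f.toFun_mul_right 0 1 q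
      rw [zero_mul, one_mul] at this
      rw [this, nrd_eq_norm_sq, abs_mul, abs_of_nonneg (sq_nonneg ‖q‖)]
      exact le_mul_of_one_le_left (abs_nonneg _) (one_le_pow₀ hq1)⟩
    have h2 : ‖q‖ ^ 2 ≤ 1 := by simpa [N] using h1
    have hd : dieudonneSq !![0, 1; q, 0] = 1 := by
      have : dieudonneSq !![0, 1; q, 0] = ‖q‖ ^ 2 := by
        simp [dieudonneSq, tr, ← nrd_eq_norm_sq]
      rw [this]
      exact le_antisymm h2 (one_le_pow₀ hq1)
    refine ⟨!![0, 1; q, 0], ?_, ?_, ?_, hle⟩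
    · intro i j
      fin_cases i <;> fin_cases j
      exacts [zero_mem _, one_mem _, hq, zero_mem _]
    · rw [hd]
      exact one_ne_zero
    · rw [hd, abs_one]
      linarith [one_le_pow₀ hE (n := 4)]
  · obtain ⟨v, hv, u, hu, hd, hdle⟩ := hR.exists_dieudonneSq_le hp0 hmin'
    refine ⟨!![p, v; q, u], ?_, hd, hdle, hle⟩
    intro i j
    fin_cases i <;> fin_cases j
    exacts [hp, hv, hq, hu]

theorem dieudonneSq_shear (l : ℍ[ℝ]) : dieudonneSq !![1, l; 0, 1] = 1 := by
  simp [dieudonneSq, tr]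

/-- Translating an integral form of nonzero discriminant makes its coefficients bounded in terms
of the first one and of the discriminant. -/
theorem exists_shear_bound (hR : IsStarLattice R e) {f : BinaryHamiltonianForm}
    (hf : f.IsIntegralOver R) (hd : f.disc ≠ 0) :
    ∃ l ∈ R, (f.comp !![1, l; 0, 1]).a = f.a ∧
      ‖(f.comp !![1, l; 0, 1]).b‖ ≤ |f.a| * (∑ i, ‖e i‖) + 1 + |f.disc| ∧
      |(f.comp !![1, l; 0, 1]).c| ≤ (|f.a| * (∑ i, ‖e i‖)) ^ 2 + 2 * |f.disc| := by
  have hE := hR.one_le_sum_norm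
  have hA : ∀ l, (f.comp !![1, l; 0, 1]).a = f.a := fun l => by simp [comp, toFun, tr]
  have hB : ∀ l, (f.comp !![1, l; 0, 1]).b = f.a • l + f.b := fun l => by
    simp [comp, Quaternion.coe_mul_eq_smul]
  have hD : ∀ l, (f.comp !![1, l; 0, 1]).disc = f.disc := fun l => by
    rw [disc_comp, dieudonneSq_shear, one_mul]
  -- Here b cannot be translated, but the discriminant is n(b) > 0. Translating by t · b shifts c by
  -- 2t times the discriminant, so c can be brought into [0, 2 disc).
  by_cases ha : f.a = 0
  · have hdb : f.disc = nrd f.b := by simp [disc, ha]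
    have hdpos : 0 < f.disc := lt_of_le_of_ne (hdb ▸ Quaternion.normSq_nonneg) hd.symm
    set t : ℤ := -⌊f.c / (2 * f.disc)⌋ with ht
    refine ⟨t • f.b, zsmul_mem hf.2.1 t, hA _, ?_, ?_⟩
    · rw [hB, ha, zero_smul, zero_add, abs_zero, zero_mul, zero_add, abs_of_pos hdpos, hdb,
        nrd_eq_norm_sq]
      nlinarith [sq_nonneg (‖f.b‖ - 1), norm_nonneg f.b]
    · have hc : (f.comp !![1, t • f.b; 0, 1]).c = 2 * f.disc * Int.fract (f.c / (2 * f.disc)) := by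
        have h1 : (star f.b * f.b).re = f.disc := by
          rw [Quaternion.star_mul_self, hdb]
          simp
        have h2 : (f.comp !![1, t • f.b; 0, 1]).c = 2 * (t * f.disc) + f.c := by
          rw [← h1]
          simp [comp, toFun, tr, ha, ← Int.cast_smul_eq_zsmul ℝ t]
        rw [h2, Int.fract, ht, mul_sub, mul_div_cancel₀ _ (by positivity)]
        push_cast
        ring
      rw [hc, ha, abs_zero, zero_mul, abs_of_pos hdpos, abs_of_nonneg
        (mul_nonneg (by positivity) (Int.fract_nonneg _))]
      nlinarith [Int.fract_lt_one (f.c / (2 * f.disc))]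
  -- Translation replaces b by b + al, so l rounds −a⁻¹b. The discriminant and |a| ≥ 1 then control
  -- c.
  · obtain ⟨l, hl, hle⟩ := hR.exists_norm_sub_le (-(f.a⁻¹ • f.b))
    have hb : ‖(f.comp !![1, l; 0, 1]).b‖ ≤ |f.a| * ∑ i, ‖e i‖ := by
      have : f.a • l + f.b = (-f.a) • (-(f.a⁻¹ • f.b) - l) := by
        rw [smul_sub, smul_neg, smul_smul, neg_mul, mul_inv_cancel₀ ha, neg_smul, neg_smul,
          one_smul]
        abel
      rw [hB, this, norm_smul, Real.norm_eq_abs, abs_neg]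
      gcongr
    refine ⟨l, hl, hA l, by linarith [abs_nonneg f.disc], ?_⟩
    have h1 := hD l
    rw [disc, hA, nrd_eq_norm_sq] at h1
    have ha1 := hR.one_le_abs hf.1 ha
    calc _ ≤ |f.a| * |(f.comp !![1, l; 0, 1]).c| := le_mul_of_one_le_left (abs_nonneg _) ha1
      _ = |‖(f.comp !![1, l; 0, 1]).b‖ ^ 2 - f.disc| := by
        rw [← abs_mul]
        congr 1
        linarith
      _ ≤ ‖(f.comp !![1, l; 0, 1]).b‖ ^ 2 + |f.disc| := by
        refine (abs_sub _ _).trans ?_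
        rw [abs_of_nonneg (sq_nonneg ‖_‖)]
      _ ≤ (|f.a| * ∑ i, ‖e i‖) ^ 2 + |f.disc| := by gcongr
      _ ≤ _ := by linarith [abs_nonneg f.disc]

/-- Integral forms of a given nonzero discriminant are transformed into finitely many forms by
nonsingular matrices with entries in `R`. -/
theorem exists_finite_comp_mem (hR : IsStarLattice R e) {δ : ℝ} (hδ : δ ≠ 0) :
    ∃ S : Set BinaryHamiltonianForm, S.Finite ∧
      ∀ f : BinaryHamiltonianForm, f.IsIntegralOver R → f.disc = δ →
        ∃ g : Matrix (Fin 2) (Fin 2) ℍ[ℝ], (∀ i j, g i j ∈ R) ∧ dieudonneSq g ≠ 0 ∧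
          f.comp g ∈ S := by
  have hE := hR.one_le_sum_norm
  set E := ∑ i, ‖e i‖ with hEdef
  -- C bounds the first coefficient and D the discriminant after the first substitution. The finite
  -- set uses the sum of the three coefficient bounds.
  set C := (4 + |δ|) * E ^ 2 with hC
  set D := 4 * E ^ 4 * |δ| with hDdef
  have hC0 : 0 ≤ C := by positivity
  have hD0 : 0 ≤ D := by positivity
  refine ⟨_, finite_integral_bounded hR (C + (C * E + 1 + D) + ((C * E) ^ 2 + 2 * D)),
    fun f hf hfδ => ?_⟩
  obtain ⟨g, hg, hgd, hgle, hga⟩ := hR.exists_comp_a_le f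
  have hF := hf.comp hR.star_mem hg
  have hFd : (f.comp g).disc = dieudonneSq g * δ := by rw [disc_comp, hfδ]
  have hFle : |(f.comp g).disc| ≤ D := by
    rw [hFd, abs_mul]
    exact mul_le_mul_of_nonneg_right hgle (abs_nonneg _)
  obtain ⟨l, hl, ha, hb, hc⟩ := hR.exists_shear_bound hF (hFd ▸ mul_ne_zero hgd hδ)
  have hs : ∀ i j, (!![1, l; 0, 1] : Matrix (Fin 2) (Fin 2) ℍ[ℝ]) i j ∈ R := by
    intro i j
    fin_cases i <;> fin_cases j
    exacts [one_mem _, hl, zero_mem _, one_mem _]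
  refine ⟨g * !![1, l; 0, 1], fun i j => ?_, ?_, ?_⟩
  · rw [Matrix.mul_apply]
    exact sum_mem fun k _ => mul_mem (hg _ _) (hs _ _)
  · rw [dieudonneSq_mul, dieudonneSq_shear, mul_one]
    exact hgd
  · rw [comp_mul]
    rw [hfδ, ← hEdef, ← hC] at hga
    have h1 : |(f.comp g).a| * E ≤ C * E := by gcongr
    have h2 : (|(f.comp g).a| * E) ^ 2 ≤ (C * E) ^ 2 := by gcongr
    have h3 : 0 ≤ C * E := by positivity
    refine ⟨hF.comp hR.star_mem hs, ?_, ?_, ?_⟩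
    · rw [ha]
      linarith [sq_nonneg (C * E)]
    · linarith [sq_nonneg (C * E)]
    · linarith

end IsStarLattice

end HamiltonBianchi

end

theorem mainTheorem6 {A : Type*} [Ring A] [Algebra ℚ A]
    [Algebra.IsCentral ℚ A] [IsSimpleRing A] (hA : Module.finrank ℚ A = 4)
    (ι : ℝ ⊗[ℚ] A ≃ₐ[ℝ] ℍ[ℝ])
    (O : Subring A) (hO : HamiltonBianchi.IsOrder O) (Δ : ℤ) (hΔ : Δ ≠ 0) :
    (HamiltonBianchi.orbits ι O hO (HamiltonBianchi.integralForms ι O Δ)).Finite ∧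
    (HamiltonBianchi.orbits ι O hO (HamiltonBianchi.posDefIntegralForms ι O Δ)).Finite ∧
    (HamiltonBianchi.orbits ι O hO (HamiltonBianchi.indefiniteIntegralForms ι O Δ)).Finite := by
  obtain ⟨n, e, he⟩ := hO.exists_basis ι
  have hR : HamiltonBianchi.IsStarLattice (HamiltonBianchi.imageInH ι O) e :=
    ⟨he, fun x hx => hO.star_mem ι hx⟩
  obtain ⟨S, hS, H⟩ := hR.exists_finite_comp_mem (Int.cast_ne_zero.2 hΔ)
  have key : (HamiltonBianchi.orbits ι O hO (HamiltonBianchi.integralForms ι O Δ)).Finite :=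
    HamiltonBianchi.finite_orbits_of_comp_mem hO hR hΔ hS (fun f hf => hf.2)
      fun f hf => H f hf.1 hf.2
  exact ⟨key, key.subset (Set.image_mono fun f hf => hf.1),
    key.subset (Set.image_mono fun f hf => hf.1)⟩
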